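/- Conventions. A multigraph $G=(V,E)$ is finite and may have loops and parallel edges. For $X\subseteq V$ let $i_G(X)$ be the number of edges (including loops) of the subgraph induced by $X$. $G$ is $(2,1)$-tight if $|E|=2|V|-1$ and $i_G(X)\le 2|X|-1$ for every nonempty $X\subseteq V$. A triple of parallel edges is a set of three distinct edges joining the same two distinct vertices. Let $\vec E$ be the set of triples $(e,v,w)$ such that $e\in E$ has ends $v,w$ (for a loop, $v=w$). For a group $\Gamma$, a gain map is a map $\phi:\vec E\to\Gamma$ such that $\phi(e,v,w)=\phi(e,w,v)^{-1}$ whenever $v\ne w$; $\phi(e,v,w)\neq\phi(e',v,w)$ for distinct edges $e,e'$ with the same ends $v,w$; and $\phi(e,v,v)\ne 1$ for every loop $e$ at $v$. Let $\Gamma\le O(2)$. For $p:V\to\mathbb R^2$, the orbit rigidity matrix $R(G,\phi,p)$ is the $|E|\times 2|V|$ matrix whose block in row $e$ and at vertex $v$ is $p(v)-\phi(e,v,w)p(w)$ if $e$ joins $v$ to some $w\neq v$; $2p(v)-\gamma p(v)-\gamma^{-1}p(v)$ if $e$ is a loop at $v$ and $\gamma=\phi(e,v,v)$; and $0$ otherwise.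 The pair $(G,\phi)$ is $\Gamma$-symmetrically rigid in $\mathbb R^2$ if there is a $p:V\to\mathbb R^2$ such that every $u:V\to\mathbb R^2$ with $R(G,\phi,p)u=0$ is trivial, i.e. there are a skew-symmetric $2\times2$ matrix $T$ and a vector $x\in\mathbb R^2$ with $\gamma u(v)=T\gamma p(v)+x$ for all $v\in V$ and $\gamma\in\Gamma$. Theorem. Let $\Gamma$ be a cyclic subgroup of $O(2)$ with $|\Gamma|=2$, and let $G=(V,E)$ be a $(2,1)$-tight multigraph with no triple of parallel edges. Then there exists a gain map $\phi:\vec E\to\Gamma$ such that $(G,\phi)$ is $\Gamma$-symmetrically rigid in $\mathbb R^2$. -/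

import Mathlib

open scoped Graph

/-- Multigraphs are Mathlib's `Graph α β`: vertex set `V(G) : Set α`, edge set `E(G) : Set β`, loops
and parallel edges allowed. `G.inducedEdgeCount X` is the number `i_G(X)` of edges of `G` in the
subgraph induced by `X`, that is, of edges (loops included) with both ends in `X`. -/
noncomputable def Graph.inducedEdgeCount {α β : Type*} (G : Graph α β) (X : Set α) : ℕ :=
  E(G.induce X).ncard

/-- `(k, l)`-sparsity (in the range `l ≤ k`): every nonempty set `X` of vertices satisfies
`i_G(X) ≤ k|X| - l`. -/
def Graph.IsSparse {α β : Type*} (G : Graph α β) (k l : ℕ) : Prop :=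
  ∀ X : Set α, X ⊆ V(G) → X.Nonempty → (G.inducedEdgeCount X : ℤ) ≤ k * X.ncard - l

/-- `(k, l)`-tightness: `(k, l)`-sparsity together with `|E| = k|V| - l`. -/
def Graph.IsTight {α β : Type*} (G : Graph α β) (k l : ℕ) : Prop :=
  G.IsSparse k l ∧ (E(G).ncard : ℤ) = k * V(G).ncard - l

/-- `G` contains a triple of parallel edges: three distinct edges joining the same two distinct
vertices. -/
def Graph.HasParallelTriple {α β : Type*} (G : Graph α β) : Prop :=
  ∃ (v w : α) (e₁ e₂ e₃ : β), v ≠ w ∧ e₁ ≠ e₂ ∧ e₁ ≠ e₃ ∧ e₂ ≠ e₃ ∧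
    G.IsLink e₁ v w ∧ G.IsLink e₂ v w ∧ G.IsLink e₃ v w

/-- A gain map of the multigraph `G` with values in the group `Γ`. It assigns a group element
`φ e v w` to every edge `e` with source `v` and sink `w`; the values at triples `(e, v, w)` where
`e` is not an edge with ends `v` and `w` carry no information and are never used. -/
structure Graph.GainMap {α β : Type*} (G : Graph α β) (Γ : Type*) [Group Γ] where
  toFun : β → α → α → Γ
  inv_eq : ∀ e v w, G.IsLink e v w → v ≠ w → toFun e v w = (toFun e w v)⁻¹
  ne_of_ne : ∀ e e' v w, e ≠ e' → G.IsLink e v w → G.IsLink e' v w → toFun e v w ≠ toFun e' v w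
  loop_ne_one : ∀ e v, G.IsLoopAt e v → toFun e v v ≠ 1

namespace Graph.GainMap

variable {α β : Type*} {G : Graph α β} {d : ℕ}
  {Γ : Subgroup (EuclideanSpace ℝ (Fin d) ≃ₗᵢ[ℝ] EuclideanSpace ℝ (Fin d))}

open Classical in
/-- The orbit rigidity matrix of the orbit framework `(G, φ, p)`, for a point group `Γ ≤ O(d)`:
its entry in row `e` and column `(v, j)` is the `j`-th coordinate of
`2 p(v) - γ p(v) - γ⁻¹ p(v)` if `e` is a loop at `v` with gain `γ = φ(e, v, v)`, of
`p(v) - γ p(w)` if `e` joins `v` to another vertex `w` with gain `γ = φ(e, v, w)`,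
and `0` if `v` is not an end of `e`. -/
noncomputable def orbitRigidityMatrix (φ : G.GainMap Γ) (p : V(G) → EuclideanSpace ℝ (Fin d)) :
    Matrix E(G) (V(G) × Fin d) ℝ :=
  Matrix.of fun e vj =>
    if G.IsLoopAt e vj.1 then
      ((2 : ℝ) • p vj.1 - (φ.toFun e vj.1 vj.1).1 (p vj.1)
        - (φ.toFun e vj.1 vj.1)⁻¹.1 (p vj.1)) vj.2
    else if h : G.Inc e vj.1 then
      (p vj.1 - (φ.toFun e vj.1 h.other).1 (p ⟨h.other, h.inc_other.vertex_mem⟩)) vj.2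
    else 0

/-- `u` is a `Γ`-symmetric infinitesimal flex of the orbit framework `(G, φ, p)`: it lies in the
kernel of the orbit rigidity matrix. -/
def IsFlex [Fintype V(G)] (φ : G.GainMap Γ) (p u : V(G) → EuclideanSpace ℝ (Fin d)) : Prop :=
  (φ.orbitRigidityMatrix p).mulVec (fun vj => u vj.1 vj.2) = 0

end Graph.GainMap

/-- The `Γ`-symmetric map `(v, γ) ↦ γ q(v)` on the vertex set `V × Γ` of the covering graph that
corresponds to a map `q` on the vertex set `V` of the gain graph. It turns orbit placements into
`Γ`-symmetric placements, and flexes of the orbit framework into flexes of the covering framework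
(the elements of a point group are linear, so they are their own linear parts). -/
noncomputable def coveringMap {V : Type*} {d : ℕ}
    (Γ : Subgroup (EuclideanSpace ℝ (Fin d) ≃ₗᵢ[ℝ] EuclideanSpace ℝ (Fin d)))
    (q : V → EuclideanSpace ℝ (Fin d)) : V × Γ → EuclideanSpace ℝ (Fin d) :=
  fun vγ => vγ.2.1 (q vγ.1)

/-- A map `u` on the vertices of a framework with placement `p` is trivial if `u = T p + x` for some
skew-symmetric matrix `T` and some vector `x`. -/
def IsTrivialFlex {V : Type*} {d : ℕ} (p u : V → EuclideanSpace ℝ (Fin d)) : Prop :=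
  ∃ (T : Matrix (Fin d) (Fin d) ℝ) (x : EuclideanSpace ℝ (Fin d)),
    T.transpose = -T ∧ ∀ v, u v = Matrix.toEuclideanLin T (p v) + x

/-- The gain graph `(G, φ)` is `Γ`-symmetrically rigid: for some orbit placement `p`, every
`Γ`-symmetric infinitesimal flex `u` of `(G, φ, p)` is trivial, which means that the corresponding
flex of the covering framework is trivial. -/
def Graph.GainMap.IsSymmetricallyRigid {α β : Type*} {G : Graph α β} [Fintype V(G)] {d : ℕ}
    {Γ : Subgroup (EuclideanSpace ℝ (Fin d) ≃ₗᵢ[ℝ] EuclideanSpace ℝ (Fin d))}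
    (φ : G.GainMap Γ) : Prop :=
  ∃ p : V(G) → EuclideanSpace ℝ (Fin d), ∀ u : V(G) → EuclideanSpace ℝ (Fin d),
    φ.IsFlex p u → IsTrivialFlex (coveringMap Γ p) (coveringMap Γ u)

/-! A group of order two acts through one nontrivial involution `σ` of the plane, the half-turn or a
reflection; gains become Booleans and edge orientations do not matter. The infinitesimal isometries
commuting with `σ` form a line, spanned by the rotation about the centre or the translation along
the mirror (`SymmetricMotion`). So rigidity means that every flex is a multiple of this motion,
which matches the count 2|V| - 1.

The proof is by induction on |V|. Since the average degree (loops counted twice) is below 4, some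
vertex `v` meets either two edges, at most one of them a loop, or three edges, none a loop. In the
first case `v` is deleted, and put back so that its two bars are independent. In the second case `v`
is deleted and an edge is added between two of its neighbours `a`, `b`, possibly a loop;
`IsTripod.exists_admissible` finds a pair that preserves tightness. To undo this, `v` is put on the
line through `p a` and `γ (p b)`: its bars to these two points imply the removed bar, and the third
bar has another direction, so `v` is fixed. The required general position is available because
rigidity is an open condition (`IsRigid.eventually`) and degeneracy is the vanishing of a nonzero
polynomial (`IsRigid.exists_cross_ne_zero`). -/

/-- A finite multigraph, given by its vertices, its edges and the pair of ends of each edge. -/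
structure FinMultigraph (α β : Type*) where
  V : Finset α
  E : Finset β
  ends : β → Sym2 α

/-! ### Sparsity counts and vertices of small degree. -/

namespace FinMultigraph

open Finset
open scoped Classical in
/-- The edges with both ends in `X`. -/
noncomputable def ind {α β : Type*} (H : FinMultigraph α β) (X : Finset α) : Finset β :=
  {e ∈ H.E | ∀ a ∈ H.ends e, a ∈ X}

open scoped Classical in
/-- The edges incident to `v`. -/
noncomputable def star {α β : Type*} (H : FinMultigraph α β) (v : α) : Finset β :=
  {e ∈ H.E | v ∈ H.ends e}

open scoped Classical in
/-- The edges with ends `a` and `b`. -/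
noncomputable def parallel {α β : Type*} (H : FinMultigraph α β) (a b : α) : Finset β :=
  {e ∈ H.E | H.ends e = s(a, b)}

/-- `(2, 1)`-tight multigraphs without triples of parallel edges. -/
structure IsTight {α β : Type*} (H : FinMultigraph α β) : Prop where
  ends_mem : ∀ e ∈ H.E, ∀ a ∈ H.ends e, a ∈ H.V
  card_eq : #H.E + 1 = 2 * #H.V
  sparse : ∀ X ⊆ H.V, X.Nonempty → #(H.ind X) + 1 ≤ 2 * #X
  parallel_le : ∀ a b, a ≠ b → #(H.parallel a b) ≤ 2

variable {α β : Type*} {H : FinMultigraph α β} {X Y : Finset α} {v a b c : α} {e e₁ e₂ e₃ : β}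

lemma mem_ind : e ∈ H.ind X ↔ e ∈ H.E ∧ ∀ a ∈ H.ends e, a ∈ X := by simp [ind]

lemma mem_star : e ∈ H.star v ↔ e ∈ H.E ∧ v ∈ H.ends e := by simp [star]

lemma mem_parallel : e ∈ H.parallel a b ↔ e ∈ H.E ∧ H.ends e = s(a, b) := by simp [parallel]

lemma parallel_comm : H.parallel a b = H.parallel b a := by
  ext; simp [mem_parallel, Sym2.eq_swap]

lemma card_ind_add_card_le {F : Finset β} (hXY : X ⊆ Y) (hFE : F ⊆ H.E)
    (hFY : ∀ e ∈ F, ∀ a ∈ H.ends e, a ∈ Y) (hFX : ∀ e ∈ F, ∃ a ∈ H.ends e, a ∉ X) :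
    #(H.ind X) + #F ≤ #(H.ind Y) := by
  classical
  rw [← card_union_of_disjoint]
  · refine card_le_card fun e he => ?_
    rcases mem_union.1 he with h | h
    · rw [mem_ind] at h ⊢
      exact ⟨h.1, fun a ha => hXY (h.2 a ha)⟩
    · exact mem_ind.2 ⟨hFE h, hFY e h⟩
  · rw [disjoint_left]
    intro e h h'
    obtain ⟨a, ha, hX⟩ := hFX e h'
    exact hX ((mem_ind.1 h).2 a ha)

lemma card_ind_add_card_ind_le [DecidableEq α] :
    #(H.ind X) + #(H.ind Y) ≤ #(H.ind (X ∪ Y)) + #(H.ind (X ∩ Y)) := by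
  classical
  rw [← card_union_add_card_inter]
  refine Nat.add_le_add (card_le_card fun e he => ?_) (card_le_card fun e he => ?_)
  · simp only [mem_union, mem_ind] at *
    grind
  · simp only [mem_inter, mem_ind] at *
    grind

open scoped Classical in
lemma IsTight.card_eq_ind_add_star (h : H.IsTight) (v : α) :
    #H.E = #(H.ind (H.V.erase v)) + #(H.star v) := by
  rw [← card_union_of_disjoint]
  · congr 1
    ext e
    simp only [mem_union, mem_ind, mem_star, mem_erase]
    have := h.ends_mem e
    grind
  · rw [disjoint_left]
    intro e he he'
    exact absurd ((mem_ind.1 he).2 v (mem_star.1 he').2) (by simp)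

lemma IsTight.nonempty (h : H.IsTight) : H.V.Nonempty := by
  rw [← card_pos]; have := h.card_eq; omega

/-- With at most one edge at `v`, the other |V| - 1 vertices would induce at least 2|V| - 2 edges,
too many for sparsity. -/
lemma IsTight.two_le_card_star (h : H.IsTight) (hv : v ∈ H.V) (hV : 2 ≤ #H.V) :
    2 ≤ #(H.star v) := by
  classical
  have h1 := h.card_eq_ind_add_star v
  have h2 := h.card_eq
  have h3 := card_erase_of_mem hv
  have h4 := h.sparse (H.V.erase v) (erase_subset _ _) (by rw [← card_pos]; omega)
  omega

/-- The summand `#(H.parallel v v)` makes loops count twice, so these degrees sum to 2|E| = 4|V| - 2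
< 4|V|. -/
lemma IsTight.exists_card_star_add_le (h : H.IsTight) :
    ∃ v ∈ H.V, #(H.star v) + #(H.parallel v v) ≤ 3 := by
  classical
  by_contra! hc
  have h1 : #H.V * 4 ≤ ∑ v ∈ H.V, (#(H.star v) + #(H.parallel v v)) := by
    rw [← smul_eq_mul]
    exact card_nsmul_le_sum _ _ _ fun v hv => hc v hv
  have h2 : ∑ v ∈ H.V, (#(H.star v) + #(H.parallel v v)) = ∑ _e ∈ H.E, 2 := by
    simp only [star, parallel, card_filter, ← sum_add_distrib]
    rw [sum_comm]
    refine sum_congr rfl fun e he => ?_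
    have hm := h.ends_mem e he
    induction hx : H.ends e with | _ a b
    rw [hx] at hm
    have ha := hm a (by simp)
    have hb := hm b (by simp)
    rw [sum_add_distrib, ← card_filter, ← card_filter]
    by_cases hab : a = b
    · subst hab
      rw [show ({v ∈ H.V | v ∈ s(a, a)} : Finset α) = {a} by ext; simp; grind,
        show ({v ∈ H.V | s(a, a) = s(v, v)} : Finset α) = {a} by ext; simp; grind]
      simp
    · rw [show ({v ∈ H.V | v ∈ s(a, b)} : Finset α) = {a, b} by ext; simp; grind,
        show ({v ∈ H.V | s(a, b) = s(v, v)} : Finset α) = ∅ by ext; simp; grind]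
      simp [hab]
  have h3 := h.card_eq
  simp at h2
  omega

open scoped Classical in
/-- Deletion of a vertex. -/
noncomputable def deleteVertex (H : FinMultigraph α β) (v : α) : FinMultigraph α β where
  V := H.V.erase v
  E := H.E \ H.star v
  ends := H.ends

lemma IsTight.deleteVertex (h : H.IsTight) (hv : v ∈ H.V) (hs : #(H.star v) = 2)
    (hV : 2 ≤ #H.V) : (H.deleteVertex v).IsTight where
  ends_mem e he a ha := by
    simp only [FinMultigraph.deleteVertex, mem_sdiff, mem_star, mem_erase] at *
    exact ⟨by rintro rfl; exact he.2 ⟨he.1, ha⟩, h.ends_mem e he.1 a ha⟩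
  card_eq := by
    classical
    have h1 := h.card_eq
    have h2 := card_erase_of_mem hv
    have h3 := card_sdiff_of_subset (fun e he => (mem_star.1 he).1 : H.star v ⊆ H.E)
    simp only [FinMultigraph.deleteVertex]
    omega
  sparse X hX hX' := by
    classical
    refine le_trans ?_ (h.sparse X (hX.trans (erase_subset _ _)) hX')
    gcongr
    intro e he
    simp only [FinMultigraph.deleteVertex, mem_ind, mem_sdiff] at *
    exact ⟨he.1.1, he.2⟩
  parallel_le a b hab := by
    refine le_trans (card_le_card fun e he => ?_) (h.parallel_le a b hab)
    simp only [FinMultigraph.deleteVertex, mem_parallel, mem_sdiff] at *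
    exact ⟨he.1.1, he.2⟩

/-! ### Tripods and admissible pairs. -/

/-- The three edges `e₁, e₂, e₃` are the edges incident to `v`, and they join it to `a, b, c`. -/
structure IsTripod (H : FinMultigraph α β) (v : α) (e₁ e₂ e₃ : β) (a b c : α) : Prop where
  mem_star : ∀ e, e ∈ H.E → v ∈ H.ends e → e = e₁ ∨ e = e₂ ∨ e = e₃
  mem₁ : e₁ ∈ H.E
  mem₂ : e₂ ∈ H.E
  mem₃ : e₃ ∈ H.E
  ne₁₂ : e₁ ≠ e₂
  ne₁₃ : e₁ ≠ e₃
  ne₂₃ : e₂ ≠ e₃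
  ends₁ : H.ends e₁ = s(v, a)
  ends₂ : H.ends e₂ = s(v, b)
  ends₃ : H.ends e₃ = s(v, c)
  ne_a : a ≠ v
  ne_b : b ≠ v
  ne_c : c ≠ v

lemma IsTripod.swap₁₂ (h : H.IsTripod v e₁ e₂ e₃ a b c) : H.IsTripod v e₂ e₁ e₃ b a c :=
  ⟨fun e he hv => by have := h.1 e he hv; tauto, h.3, h.2, h.4, h.5.symm, h.7, h.6, h.9, h.8, h.10,
    h.12, h.11, h.13⟩

lemma IsTripod.swap₂₃ (h : H.IsTripod v e₁ e₂ e₃ a b c) : H.IsTripod v e₁ e₃ e₂ a c b :=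
  ⟨fun e he hv => by have := h.1 e he hv; tauto, h.2, h.4, h.3, h.6, h.5, h.7.symm, h.8, h.10, h.9,
    h.11, h.13, h.12⟩

open scoped Classical in
/-- `a` and `b` may be joined by a new edge after the deletion of `v`. -/
def Admissible (H : FinMultigraph α β) (v a b : α) : Prop :=
  (∀ X ⊆ H.V.erase v, a ∈ X → b ∈ X → #(H.ind X) + 2 ≤ 2 * #X) ∧
    (a ≠ b → #(H.parallel a b) ≤ 1)

lemma Admissible.symm (h : H.Admissible v a b) : H.Admissible v b a :=
  ⟨fun X hX ha hb => h.1 X hX hb ha, fun hab => parallel_comm (H := H) ▸ h.2 hab.symm⟩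

open scoped Classical in
/-- Deletion of `v` followed by the addition of an edge labelled `e₁` with ends `a` and `b`. -/
noncomputable def reduce (H : FinMultigraph α β) (v : α) (e₁ e₂ e₃ : β) (a b : α) :
    FinMultigraph α β where
  V := H.V.erase v
  E := H.E \ {e₂, e₃}
  ends := Function.update H.ends e₁ s(a, b)

lemma IsTripod.mem_V (h : H.IsTripod v e₁ e₂ e₃ a b c) (ht : H.IsTight) :
    v ∈ H.V ∧ a ∈ H.V ∧ b ∈ H.V ∧ c ∈ H.V :=
  ⟨ht.ends_mem e₁ h.mem₁ v (by simp [h.ends₁]), ht.ends_mem e₁ h.mem₁ a (by simp [h.ends₁]),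
    ht.ends_mem e₂ h.mem₂ b (by simp [h.ends₂]), ht.ends_mem e₃ h.mem₃ c (by simp [h.ends₃])⟩

/-- Only sets containing both `a` and `b` gain an edge, and admissibility leaves room for it. The
label `e₁` is reused, so one vertex and two edges are lost. -/
lemma IsTight.reduce (ht : H.IsTight) (h : H.IsTripod v e₁ e₂ e₃ a b c)
    (hab : H.Admissible v a b) : (H.reduce v e₁ e₂ e₃ a b).IsTight := by
  classical
  obtain ⟨hv, ha, hb, -⟩ := h.mem_V ht
  have hne1 := h.ne_a
  have hne2 := h.ne_b
  refine ⟨fun e he x hx => ?_, ?_, fun X hX hX' => ?_, fun x y hxy => ?_⟩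
  · simp only [FinMultigraph.reduce, mem_sdiff, mem_insert, mem_singleton, mem_erase] at *
    by_cases he1 : e = e₁
    · subst he1
      simp only [Function.update_self, Sym2.mem_iff] at hx
      grind
    · rw [Function.update_of_ne he1] at hx
      refine ⟨?_, ht.ends_mem e he.1 x hx⟩
      rintro rfl
      have := h.mem_star e he.1 hx
      tauto
  · have h1 := ht.card_eq
    have h2 := card_erase_of_mem hv
    have h3 := card_sdiff_of_subset (s := {e₂, e₃}) (t := H.E)
      (by simp [insert_subset_iff, h.mem₂, h.mem₃])
    rw [card_pair h.ne₂₃] at h3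
    have h4 : 1 ≤ #H.V := card_pos.2 ⟨v, hv⟩
    have h5 : 1 < #H.V := one_lt_card.2 ⟨a, ha, v, hv, h.ne_a⟩
    simp only [FinMultigraph.reduce]
    omega
  · have hsub : ∀ e ∈ (H.reduce v e₁ e₂ e₃ a b).ind X, e ≠ e₁ → e ∈ H.ind X := by
      intro e he he1
      simp only [FinMultigraph.reduce, mem_ind, mem_sdiff, Function.update_of_ne he1] at *
      exact ⟨he.1.1, he.2⟩
    by_cases hX1 : a ∈ X ∧ b ∈ X
    · have h1 := hab.1 X hX hX1.1 hX1.2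
      have h2 : #((H.reduce v e₁ e₂ e₃ a b).ind X) ≤ #(insert e₁ (H.ind X)) :=
        card_le_card fun e he => by
          rw [mem_insert]
          by_cases he1 : e = e₁
          · exact Or.inl he1
          · exact Or.inr (hsub e he he1)
      have h3 := card_insert_le e₁ (H.ind X)
      omega
    · refine le_trans ?_ (ht.sparse X (hX.trans (erase_subset _ _)) hX')
      gcongr
      intro e he
      refine hsub e he ?_
      rintro rfl
      simp only [FinMultigraph.reduce, mem_ind, Function.update_self, Sym2.mem_iff] at he
      exact hX1 ⟨he.2 a (by simp), he.2 b (by simp)⟩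
  · have hsub : ∀ e ∈ (H.reduce v e₁ e₂ e₃ a b).parallel x y, e ≠ e₁ → e ∈ H.parallel x y := by
      intro e he he1
      simp only [FinMultigraph.reduce, mem_parallel, mem_sdiff, Function.update_of_ne he1] at *
      exact ⟨he.1.1, he.2⟩
    by_cases hxy' : s(a, b) = s(x, y)
    · have h0 : H.parallel x y = H.parallel a b := by simp only [parallel, hxy']
      have hab' : a ≠ b := by
        rintro rfl
        simp at hxy'
        grind
      have h1 := hab.2 hab'
      have h2 : #((H.reduce v e₁ e₂ e₃ a b).parallel x y) ≤ #(insert e₁ (H.parallel x y)) :=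
        card_le_card fun e he => by
          rw [mem_insert]
          by_cases he1 : e = e₁
          · exact Or.inl he1
          · exact Or.inr (hsub e he he1)
      have h3 := card_insert_le e₁ (H.parallel x y)
      rw [h0] at h2 h3
      omega
    · refine le_trans (card_le_card fun e he => hsub e he ?_) (ht.parallel_le x y hxy)
      rintro rfl
      simp only [FinMultigraph.reduce, mem_parallel, Function.update_self] at he
      exact hxy' he.2

/-- Adding `v` to `X` brings three edges but raises the sparsity bound only by two. -/
lemma IsTripod.card_ind_add_two_le (h : H.IsTripod v e₁ e₂ e₃ a b c) (ht : H.IsTight)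
    [DecidableEq α] (hX : X ⊆ H.V.erase v) (ha : a ∈ X) (hb : b ∈ X) (hc : c ∈ X) :
    #(H.ind X) + 2 ≤ 2 * #X := by
  classical
  have hvX : v ∉ X := fun hv => by simpa using hX hv
  obtain ⟨hv, -⟩ := h.mem_V ht
  have h1 := ht.sparse (insert v X)
    (insert_subset_iff.2 ⟨hv, hX.trans (erase_subset _ _)⟩) (insert_nonempty _ _)
  have h2 := card_ind_add_card_le (H := H) (X := X) (Y := insert v X) (F := {e₁, e₂, e₃})
    (subset_insert _ _) (by simp [insert_subset_iff, h.mem₁, h.mem₂, h.mem₃])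
    (by simp [h.ends₁, h.ends₂, h.ends₃, ha, hb, hc])
    (by simp [h.ends₁, h.ends₂, h.ends₃, hvX])
  rw [card_eq_three.2 ⟨e₁, e₂, e₃, h.ne₁₂, h.ne₁₃, h.ne₂₃, rfl⟩] at h2
  rw [card_insert_of_notMem hvX] at h1
  omega

/-- Two tight sets that meet have a tight union. -/
lemma IsTight.card_ind_union [DecidableEq α] (ht : H.IsTight) (hX : X ⊆ H.V)
    (hXY : (X ∩ Y).Nonempty) (h1 : 2 * #X < #(H.ind X) + 2) (h2 : 2 * #Y < #(H.ind Y) + 2) :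
    2 * #(X ∪ Y) < #(H.ind (X ∪ Y)) + 2 := by
  have h3 := card_ind_add_card_ind_le (H := H) (X := X) (Y := Y)
  have h4 := ht.sparse (X ∩ Y) (inter_subset_left.trans hX) hXY
  have h5 := card_union_add_card_inter X Y
  omega

/-- Joining a vertex to a tight set by four edges violates sparsity. -/
lemma IsTight.false_of_two_parallel (ht : H.IsTight) (hX : X ⊆ H.V)
    (h1 : 2 * #X < #(H.ind X) + 2) (ha : a ∈ X) (hc : c ∈ X) (hac : a ≠ c) (hb : b ∈ H.V)
    (hbX : b ∉ X) (hab : 1 < #(H.parallel a b)) (hcb : 1 < #(H.parallel b c)) : False := by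
  classical
  have h2 := ht.sparse (insert b X) (insert_subset_iff.2 ⟨hb, hX⟩) (insert_nonempty _ _)
  have h3 := card_ind_add_card_le (H := H) (X := X) (Y := insert b X)
    (F := H.parallel a b ∪ H.parallel b c)
    (subset_insert _ _) (union_subset (filter_subset _ _) (filter_subset _ _))
    (by
      intro e he
      rcases mem_union.1 he with h | h
      all_goals rw [(mem_parallel.1 h).2]; simp [ha, hc])
    (by
      intro e he
      refine ⟨b, ?_, hbX⟩
      rcases mem_union.1 he with h | h
      all_goals rw [(mem_parallel.1 h).2]; simp)
  rw [card_union_of_disjoint, card_insert_of_notMem hbX] at *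
  · omega
  · rw [disjoint_left]
    intro e he he'
    have := (mem_parallel.1 he).2.symm.trans (mem_parallel.1 he').2
    simp at this
    grind

/-- A tight set through `a` and `c` either contains `b`, hence all neighbours of `v`, or can be
enlarged by `b` with four edges. A double edge `ac` would give six edges on three vertices. -/
lemma IsTripod.admissible_of_parallel (h : H.IsTripod v e₁ e₂ e₃ a b c) (ht : H.IsTight)
    (hab : a ≠ b) (hac : a ≠ c) (hbc : b ≠ c) (h1 : 1 < #(H.parallel a b))
    (h2 : 1 < #(H.parallel b c)) : H.Admissible v a c := by
  classical
  obtain ⟨hv, ha, hb, hc⟩ := h.mem_V ht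
  refine ⟨fun X hX haX hcX => ?_, fun _ => ?_⟩
  · by_contra! hX1
    by_cases hbX : b ∈ X
    · exact absurd (h.card_ind_add_two_le ht hX haX hbX hcX) (by omega)
    · exact ht.false_of_two_parallel (hX.trans (erase_subset _ _)) hX1 haX hcX hac hb hbX h1 h2
  · by_contra! h3
    have h4 := ht.sparse {a, b, c} (by simp [insert_subset_iff, *]) (by simp)
    rw [card_eq_three.2 ⟨a, b, c, hab, hac, hbc, rfl⟩] at h4
    have h5 : H.parallel a b ∪ (H.parallel b c ∪ H.parallel a c) ⊆ H.ind {a, b, c} := by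
      intro e he
      simp only [mem_union, mem_parallel, mem_ind] at *
      rcases he with h | h | h <;> refine ⟨h.1, ?_⟩ <;> rw [h.2] <;> simp
    have h6 := card_le_card h5
    rw [card_union_of_disjoint, card_union_of_disjoint] at h6
    · omega
    · rw [disjoint_left]
      intro e he he'
      have := (mem_parallel.1 he).2.symm.trans (mem_parallel.1 he').2
      simp at this
      grind
    · rw [disjoint_left]
      intro e he he'
      rcases mem_union.1 he' with he' | he' <;>
      · have := (mem_parallel.1 he).2.symm.trans (mem_parallel.1 he').2
        simp at this
        grind

/-- A pair is blocked by a double edge or by a tight set. Two double edges leave the third pair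
admissible. Otherwise two pairs are blocked by tight sets, which share a neighbour of `v`; their
union is tight and contains all three neighbours, which is impossible. -/
lemma IsTripod.admissible_of_ne (h : H.IsTripod v e₁ e₂ e₃ a b c) (ht : H.IsTight)
    (hab : a ≠ b) (hac : a ≠ c) (hbc : b ≠ c) :
    H.Admissible v a b ∨ H.Admissible v b c ∨ H.Admissible v a c := by
  classical
  by_contra! hcon
  obtain ⟨h1, h2, h3⟩ := hcon
  have key : ∀ x y, x ≠ y → ¬ H.Admissible v x y → ¬ 1 < #(H.parallel x y) →
      ∃ X ⊆ H.V.erase v, x ∈ X ∧ y ∈ X ∧ 2 * #X < #(H.ind X) + 2 := by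
    intro x y hxy hn hp
    by_contra! hX
    exact hn ⟨fun X h1 h2 h3 => hX X h1 h2 h3, fun _ => not_lt.1 hp⟩
  have meet : ∀ X Y : Finset α, X ⊆ H.V.erase v → Y ⊆ H.V.erase v → (X ∩ Y).Nonempty →
      a ∈ X ∪ Y → b ∈ X ∪ Y → c ∈ X ∪ Y → 2 * #X < #(H.ind X) + 2 →
      2 * #Y < #(H.ind Y) + 2 → False := by
    intro X Y hX hY hne ha hb hc h4 h5
    have h6 := ht.card_ind_union (hX.trans (erase_subset _ _)) hne h4 h5
    exact absurd (h.card_ind_add_two_le ht (union_subset hX hY) ha hb hc) (by omega)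
  by_cases p1 : 1 < #(H.parallel a b) <;> by_cases p2 : 1 < #(H.parallel b c)
  · exact h3 (h.admissible_of_parallel ht hab hac hbc p1 p2)
  · by_cases p3 : 1 < #(H.parallel a c)
    · exact h2 (h.swap₁₂.admissible_of_parallel ht hab.symm hbc hac (parallel_comm (H := H) ▸ p1) p3)
    · obtain ⟨X, hX, x1, x2, x3⟩ := key _ _ hbc h2 p2
      obtain ⟨Y, hY, y1, y2, y3⟩ := key _ _ hac h3 p3
      exact meet X Y hX hY ⟨c, by simp [*]⟩ (by simp [*]) (by simp [*]) (by simp [*]) x3 y3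
  · by_cases p3 : 1 < #(H.parallel a c)
    · exact h1 (h.swap₂₃.admissible_of_parallel ht hac hab hbc.symm p3
        (parallel_comm (H := H) ▸ p2))
    · obtain ⟨X, hX, x1, x2, x3⟩ := key _ _ hab h1 p1
      obtain ⟨Y, hY, y1, y2, y3⟩ := key _ _ hac h3 p3
      exact meet X Y hX hY ⟨a, by simp [*]⟩ (by simp [*]) (by simp [*]) (by simp [*]) x3 y3
  · obtain ⟨X, hX, x1, x2, x3⟩ := key _ _ hab h1 p1
    obtain ⟨Y, hY, y1, y2, y3⟩ := key _ _ hbc h2 p2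
    exact meet X Y hX hY ⟨b, by simp [*]⟩ (by simp [*]) (by simp [*]) (by simp [*]) x3 y3

/-- A set containing `a` and `c` contains all neighbours of `v`, so only a double edge can block
`ac`. In that case a tight set through `a` that misses `c` would become too dense on adding `c`, so
a loop at `a` is possible. -/
lemma IsTripod.admissible_of_eq (h : H.IsTripod v e₁ e₂ e₃ a a c) (ht : H.IsTight) :
    H.Admissible v a c ∨ H.Admissible v a a := by
  classical
  obtain ⟨hv, ha, -, hc⟩ := h.mem_V ht
  by_cases p : 1 < #(H.parallel a c)
  · right
    refine ⟨fun X hX haX _ => ?_, fun hh => absurd rfl hh⟩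
    by_contra! hX1
    have hvX : v ∉ X := fun hv => by simpa using hX hv
    by_cases hcX : c ∈ X
    · exact absurd (h.card_ind_add_two_le ht hX haX haX hcX) (by omega)
    have hcV : insert c X ⊆ H.V.erase v :=
      insert_subset_iff.2 ⟨mem_erase.2 ⟨h.ne_c, hc⟩, hX⟩
    have h2 := h.card_ind_add_two_le ht hcV (by simp [haX]) (by simp [haX]) (by simp)
    have h3 := card_ind_add_card_le (H := H) (X := X) (Y := insert c X) (F := H.parallel a c)
      (subset_insert _ _) (filter_subset _ _)
      (fun e he => by rw [(mem_parallel.1 he).2]; simp [haX])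
      (fun e he => ⟨c, by rw [(mem_parallel.1 he).2]; simp, hcX⟩)
    rw [card_insert_of_notMem hcX] at h2
    omega
  · left
    refine ⟨fun X hX haX hcX => h.card_ind_add_two_le ht hX haX haX hcX, fun _ => not_lt.1 p⟩

/-- The neighbours of a tripod can be relabelled so that the first two may be joined. -/
lemma IsTripod.exists_admissible (h : H.IsTripod v e₁ e₂ e₃ a b c) (ht : H.IsTight) :
    ∃ e₁ e₂ e₃ a b c, H.IsTripod v e₁ e₂ e₃ a b c ∧ b ≠ c ∧ H.Admissible v a b := by
  classical
  have eq_case : ∀ {e₁ e₂ e₃ a c}, H.IsTripod v e₁ e₂ e₃ a a c → a ≠ c →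
      ∃ e₁ e₂ e₃ a b c, H.IsTripod v e₁ e₂ e₃ a b c ∧ b ≠ c ∧ H.Admissible v a b := by
    intro e₁ e₂ e₃ a c h hac
    rcases h.admissible_of_eq ht with h1 | h1
    · exact ⟨_, _, _, _, _, _, h.swap₂₃, hac.symm, h1⟩
    · exact ⟨_, _, _, _, _, _, h, hac, h1⟩
  have htriple : ¬ (a = b ∧ a = c) := by
    rintro ⟨rfl, rfl⟩
    have h1 := ht.parallel_le v a h.ne_a.symm
    have h2 : ({e₁, e₂, e₃} : Finset β) ⊆ H.parallel v a := by
      simp [insert_subset_iff, mem_parallel, h.mem₁, h.mem₂, h.mem₃, h.ends₁, h.ends₂, h.ends₃]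
    have h3 := card_le_card h2
    rw [card_eq_three.2 ⟨e₁, e₂, e₃, h.ne₁₂, h.ne₁₃, h.ne₂₃, rfl⟩] at h3
    omega
  by_cases hab : a = b
  · subst hab
    exact eq_case h (by simpa using htriple)
  by_cases hac : a = c
  · subst hac
    exact eq_case h.swap₂₃ hab
  by_cases hbc : b = c
  · subst hbc
    exact eq_case h.swap₁₂.swap₂₃ (Ne.symm hab)
  rcases h.admissible_of_ne ht hab hac hbc with h1 | h1 | h1
  · exact ⟨_, _, _, _, _, _, h, hbc, h1⟩
  · exact ⟨_, _, _, _, _, _, h.swap₁₂.swap₂₃, Ne.symm hac, h1⟩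
  · exact ⟨_, _, _, _, _, _, h.swap₂₃, Ne.symm hbc, h1⟩

end FinMultigraph

/-! ### Plane vectors and symmetric infinitesimal motions. -/

open scoped Topology InnerProductSpace

/-- The Euclidean plane. -/
abbrev Plane := EuclideanSpace ℝ (Fin 2)

namespace Plane

/-- The determinant of two vectors of the plane. -/
noncomputable def cross (x y : Plane) : ℝ := x 0 * y 1 - x 1 * y 0

lemma inner_eq (x y : Plane) : ⟪x, y⟫_ℝ = x 0 * y 0 + x 1 * y 1 := by
  simp [PiLp.inner_apply, Fin.sum_univ_two]; ring

lemma ext_coord {x y : Plane} (h0 : x 0 = y 0) (h1 : x 1 = y 1) : x = y := by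
  ext i; fin_cases i <;> assumption

lemma eq_zero_of_inner_eq_zero {d₁ d₂ w : Plane} (h : cross d₁ d₂ ≠ 0) (h1 : ⟪d₁, w⟫_ℝ = 0)
    (h2 : ⟪d₂, w⟫_ℝ = 0) : w = 0 := by
  rw [inner_eq] at h1 h2
  apply ext_coord
  · apply mul_left_cancel₀ h
    simp only [cross, PiLp.zero_apply]
    linear_combination d₂ 1 * h1 - d₁ 1 * h2
  · apply mul_left_cancel₀ h
    simp only [cross, PiLp.zero_apply]
    linear_combination d₁ 0 * h2 - d₂ 0 * h1

lemma exists_cross_ne_zero {x : Plane} (h : x ≠ 0) : ∃ y, cross x y ≠ 0 := by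
  refine ⟨!₂[-x 1, x 0], fun hc => h ?_⟩
  simp only [cross, Matrix.cons_val_zero, Matrix.cons_val_one] at hc
  apply ext_coord <;> simp only [PiLp.zero_apply] <;> nlinarith [sq_nonneg (x 0), sq_nonneg (x 1)]

lemma cross_swap (x y : Plane) : cross y x = -cross x y := by
  simp only [cross]; ring

end Plane

open Plane

/-- The identity or `σ`, depending on a gain in a group of order two. -/
noncomputable def twist (σ : Plane ≃ₗᵢ[ℝ] Plane) : Bool → (Plane ≃ₗᵢ[ℝ] Plane)
  | false => LinearIsometryEquiv.refl ℝ Plane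
  | true => σ

@[simp]
lemma twist_false_apply (σ : Plane ≃ₗᵢ[ℝ] Plane) (z : Plane) : twist σ false z = z := rfl

@[simp]
lemma twist_true_apply (σ : Plane ≃ₗᵢ[ℝ] Plane) (z : Plane) : twist σ true z = σ z := rfl

/-- A nontrivial linear involution `σ` of the plane with an infinitesimal isometry
`z ↦ T z + x` that commutes with it, and spans the symmetric infinitesimal motions of a suitable
symmetric bar. -/
structure SymmetricMotion (σ : Plane ≃ₗᵢ[ℝ] Plane) where
  T : Plane →L[ℝ] Plane
  x : Plane
  invol : ∀ z, σ (σ z) = z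
  inner_T : ∀ z, ⟪z, T z⟫_ℝ = 0
  T_comm : ∀ z, T (σ z) = σ (T z)
  fix_x : σ x = x
  exists_span : ∃ q, ∀ u, ⟪q - σ q, u - σ u⟫_ℝ = 0 → ∃ c : ℝ, u = c • (T q + x)
  exists_ne : ∃ q, σ q ≠ q

namespace SymmetricMotion

variable {σ : Plane ≃ₗᵢ[ℝ] Plane} (M : SymmetricMotion σ)

/-- The velocity at `z`. -/
noncomputable def field (z : Plane) : Plane := M.T z + M.x

include M in
lemma twist_twist (b : Bool) (z : Plane) : twist σ b (twist σ b z) = z := by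
  cases b
  · rfl
  · exact M.invol z

/-- The translation part is fixed by `σ` and cancels. Since `T` is skew, `field` is therefore a flex
of every gain graph. -/
lemma field_sub_twist (b : Bool) (y z : Plane) :
    M.field y - twist σ b (M.field z) = M.T (y - twist σ b z) := by
  cases b
  · simp [field, twist]
  · simp [field, twist, M.fix_x, M.T_comm]

@[fun_prop]
lemma continuous_field : Continuous M.field := by unfold field; fun_prop

-- Applying the isometric involution `twist σ b` exchanges the roles of the two ends, so the flex
-- condition of an edge does not depend on their order.
include M in
lemma inner_sub_twist (b : Bool) (y z y' z' : Plane) :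
    ⟪z - twist σ b y, z' - twist σ b y'⟫_ℝ = ⟪y - twist σ b z, y' - twist σ b z'⟫_ℝ := by
  rw [← (twist σ b).inner_map_map]
  simp only [map_sub, M.twist_twist]
  rw [← neg_sub y, ← neg_sub y', inner_neg_neg]

end SymmetricMotion

/-! ### Flexes, rigidity and perturbation of placements. -/

namespace FinMultigraph

variable {α β : Type*} {H H' : FinMultigraph α β} {σ : Plane ≃ₗᵢ[ℝ] Plane} {g g' : β → Bool}
  {p u w : α → Plane} {v : α} {M : SymmetricMotion σ}

/-- Infinitesimal flexes of the gain graph `(H, g)` with placement `p`. -/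
def IsFlex (H : FinMultigraph α β) (σ : Plane ≃ₗᵢ[ℝ] Plane) (g : β → Bool) (p u : α → Plane) :
    Prop :=
  ∀ e ∈ H.E, ∀ a b, H.ends e = s(a, b) →
    ⟪p a - twist σ (g e) (p b), u a - twist σ (g e) (u b)⟫_ℝ = 0

/-- All infinitesimal flexes are multiples of the motion `M`. -/
def IsRigid (H : FinMultigraph α β) (M : SymmetricMotion σ) (g : β → Bool) (p : α → Plane) : Prop :=
  ∀ u, H.IsFlex σ g p u → ∃ c : ℝ, ∀ v ∈ H.V, u v = c • M.field (p v)

/-- Parallel edges have distinct gains and loops have nontrivial gains. -/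
structure IsGain (H : FinMultigraph α β) (g : β → Bool) : Prop where
  ne : ∀ e ∈ H.E, ∀ e' ∈ H.E, e ≠ e' → H.ends e = H.ends e' → g e ≠ g e'
  loop : ∀ e ∈ H.E, ∀ a, H.ends e = s(a, a) → g e = true

lemma IsFlex.sub_smul_field (h : H.IsFlex σ g p u) (M : SymmetricMotion σ) (c : ℝ) :
    H.IsFlex σ g p fun v => u v - c • M.field (p v) := by
  intro e he a b hab
  have h1 := h e he a b hab
  have h2 : (u a - c • M.field (p a)) - twist σ (g e) (u b - c • M.field (p b))
      = (u a - twist σ (g e) (u b)) - c • M.T (p a - twist σ (g e) (p b)) := by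
    rw [← M.field_sub_twist, map_sub, map_smul, smul_sub]
    abel
  rw [h2, inner_sub_right, h1, inner_smul_right, M.inner_T]
  simp

lemma IsFlex.smul (h : H.IsFlex σ g p u) (c : ℝ) : H.IsFlex σ g p (c • u) := by
  intro e he a b hab
  have h1 := h e he a b hab
  simp only [Pi.smul_apply, map_smul, ← smul_sub, inner_smul_right, h1, mul_zero]

lemma IsFlex.congr (hH : ∀ e ∈ H.E, ∀ a ∈ H.ends e, a ∈ H.V) {p' u' : α → Plane}
    (h : H.IsFlex σ g p u) (hp : ∀ v ∈ H.V, p v = p' v) (hu : ∀ v ∈ H.V, u v = u' v) :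
    H.IsFlex σ g p' u' := by
  intro e he a b hab
  have ha := hH e he a (by simp [hab])
  have hb := hH e he b (by simp [hab])
  rw [← hp a ha, ← hp b hb, ← hu a ha, ← hu b hb]
  exact h e he a b hab

lemma IsRigid.congr (hH : ∀ e ∈ H.E, ∀ a ∈ H.ends e, a ∈ H.V) {p' : α → Plane}
    (h : H.IsRigid M g p) (hp : ∀ v ∈ H.V, p v = p' v) : H.IsRigid M g p' := by
  intro u hu
  obtain ⟨c, hc⟩ := h u (hu.congr hH (fun v hv => (hp v hv).symm) fun _ _ => rfl)
  exact ⟨c, fun v hv => by rw [hc v hv, hp v hv]⟩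

lemma isClosed_setOf_isFlex (H : FinMultigraph α β) (σ : Plane ≃ₗᵢ[ℝ] Plane) (g : β → Bool) :
    IsClosed {z : (α → Plane) × (α → Plane) | H.IsFlex σ g z.1 z.2} := by
  simp only [IsFlex, Set.ofPred_forall]
  refine isClosed_iInter fun e => isClosed_iInter fun he => isClosed_iInter fun a =>
    isClosed_iInter fun b => isClosed_iInter fun hab => isClosed_eq ?_ continuous_const
  have h1 := (twist σ (g e)).continuous
  fun_prop

/-- Rigidity is an open condition on the placement. -/
lemma IsRigid.eventually [Fintype α] (hH : ∀ e ∈ H.E, ∀ a ∈ H.ends e, a ∈ H.V)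
    (h : H.IsRigid M g p) : ∀ᶠ p' in 𝓝 p, H.IsRigid M g p' := by
  classical
  -- Rigidity says that no unit vector supported on `H.V` is a flex orthogonal to the field of `M`.
  -- Such vectors range over a compact set and the condition `hclosed` is closed, so their absence
  -- persists near `p`.
  let K : Set (α → Plane) := Metric.sphere 0 1 ∩ {u | ∀ v, v ∉ H.V → u v = 0}
  have hK : IsCompact K := by
    refine (isCompact_sphere _ _).inter_right ?_
    simp only [Set.ofPred_forall]
    exact isClosed_iInter fun v => isClosed_iInter fun _ =>
      isClosed_eq (continuous_apply v) continuous_const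
  let ℓ : (α → Plane) → (α → Plane) → ℝ := fun p u => ∑ v ∈ H.V, ⟪M.field (p v), u v⟫_ℝ
  have hclosed : IsClosed {z : (α → Plane) × (α → Plane) | H.IsFlex σ g z.1 z.2 ∧ ℓ z.1 z.2 = 0} := by
    refine (H.isClosed_setOf_isFlex σ g).inter (isClosed_eq ?_ continuous_const)
    have := M.continuous_field
    fun_prop
  have hev : ∀ᶠ p' in 𝓝 p, ∀ u ∈ K, ¬ (H.IsFlex σ g p' u ∧ ℓ p' u = 0) := by
    refine hK.eventually_forall_of_forall_eventually fun u hu => ?_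
    refine hclosed.isOpen_compl.eventually_mem (x := (p, u)) ?_
    rintro ⟨hflex, hℓ⟩
    obtain ⟨c, hc⟩ := h u hflex
    change ℓ p u = 0 at hℓ
    have h0 : u = 0 := by
      have h1 : c * ∑ v ∈ H.V, ‖M.field (p v)‖ ^ 2 = 0 := by
        rw [← hℓ, Finset.mul_sum]
        refine Finset.sum_congr rfl fun v hv => ?_
        rw [hc v hv, inner_smul_right, real_inner_self_eq_norm_sq]
      funext v
      by_cases hv : v ∈ H.V
      · rw [hc v hv]
        rcases mul_eq_zero.1 h1 with h2 | h2
        · simp [h2]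
        · rw [Finset.sum_eq_zero_iff_of_nonneg (fun _ _ => by positivity)] at h2
          have := h2 v hv
          simp at this
          simp [this]
      · exact hu.2 v hv
    have h1 := hu.1
    simp [h0] at h1
  filter_upwards [hev] with p' hp' u hu
  set S := ∑ v ∈ H.V, ‖M.field (p' v)‖ ^ 2 with hS
  -- The component of `u` orthogonal to the field. If `S = 0`, the quotient is `0`, and the field
  -- vanishes on `H.V`, so orthogonality is automatic.
  let w : α → Plane := fun v => if v ∈ H.V then u v - (ℓ p' u / S) • M.field (p' v) else 0
  have hw : H.IsFlex σ g p' w :=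
    (hu.sub_smul_field M (ℓ p' u / S)).congr hH (fun _ _ => rfl) fun v hv => by simp [w, hv]
  have hℓ : ℓ p' w = 0 := by
    have h1 : ℓ p' w = ℓ p' u - (ℓ p' u / S) * S := by
      simp only [ℓ, hS]
      rw [Finset.mul_sum, ← Finset.sum_sub_distrib]
      refine Finset.sum_congr rfl fun v hv => ?_
      simp only [w, hv, if_true, inner_sub_right, inner_smul_right, real_inner_self_eq_norm_sq]
      rfl
    rw [h1]
    by_cases hS0 : S = 0
    · rw [hS0, mul_zero, sub_zero]
      refine Finset.sum_eq_zero fun v hv => ?_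
      rw [hS, Finset.sum_eq_zero_iff_of_nonneg (fun _ _ => by positivity)] at hS0
      have := hS0 v hv
      simp at this
      simp [this]
    · rw [div_mul_cancel₀ _ hS0, sub_self]
  have hw0 : w = 0 := by
    by_contra hne
    refine hp' (‖w‖⁻¹ • w) ⟨?_, fun v hv => by simp [w, hv]⟩ ⟨hw.smul _, ?_⟩
    · simp [norm_smul, hne]
    · have : ℓ p' (‖w‖⁻¹ • w) = ‖w‖⁻¹ * ℓ p' w := by
        simp [ℓ, Finset.mul_sum, inner_smul_right]
      rw [this, hℓ, mul_zero]
  refine ⟨ℓ p' u / S, fun v hv => ?_⟩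
  have := congrFun hw0 v
  simpa [w, hv, sub_eq_zero] using this

/-- A rigid placement may be moved away from a quadratic hypersurface. -/
lemma IsRigid.exists_cross_ne_zero [Fintype α] (hH : ∀ e ∈ H.E, ∀ a ∈ H.ends e, a ∈ H.V)
    (h : H.IsRigid M g p) (γ δ : Bool) (a b c : α) (q : α → Plane)
    (hq : cross (twist σ γ (q b) - q a) (twist σ δ (q c) - q a) ≠ 0) :
    ∃ p', H.IsRigid M g p' ∧ cross (twist σ γ (p' b) - p' a) (twist σ δ (p' c) - p' a) ≠ 0 := by
  let d₁ : (α → Plane) → Plane := fun p => twist σ γ (p b) - p a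
  let d₂ : (α → Plane) → Plane := fun p => twist σ δ (p c) - p a
  -- The determinant along the line `p + t • q`; its leading coefficient is the determinant at `q`.
  let P : Polynomial ℝ := .C (cross (d₁ q) (d₂ q)) * .X ^ 2 +
    .C (cross (d₁ p) (d₂ q) + cross (d₁ q) (d₂ p)) * .X + .C (cross (d₁ p) (d₂ p))
  have hP : P ≠ 0 := by
    intro h0
    have h1 := congrArg (fun P => Polynomial.coeff P 2) h0
    simp [P] at h1
    exact hq h1
  have heval : ∀ t : ℝ, cross (d₁ (p + t • q)) (d₂ (p + t • q)) = P.eval t := by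
    intro t
    simp only [P, d₁, d₂, cross, Pi.add_apply, Pi.smul_apply, map_add, map_smul,
      Polynomial.eval_add, Polynomial.eval_mul, Polynomial.eval_C, Polynomial.eval_pow,
      Polynomial.eval_X, PiLp.add_apply, PiLp.sub_apply, PiLp.smul_apply, smul_eq_mul]
    ring
  have h1 : ∀ᶠ t in 𝓝[≠] (0 : ℝ), P.eval t ≠ 0 := by
    have hfin : {t | P.eval t = 0}.Finite := by
      refine (P.roots.toFinset.finite_toSet).subset fun t ht => ?_
      simpa [hP] using ht
    have := (hfin.subset (Set.sdiff_subset (t := {0}))).isClosed.isOpen_compl.mem_nhds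
      (x := (0 : ℝ)) (by simp)
    filter_upwards [nhdsWithin_le_nhds this, self_mem_nhdsWithin] with t ht ht0 hev
    exact ht ⟨hev, ht0⟩
  have h2 : ∀ᶠ t in 𝓝[≠] (0 : ℝ), H.IsRigid M g (p + t • q) := by
    apply nhdsWithin_le_nhds
    have hc : Continuous fun t : ℝ => p + t • q := by fun_prop
    have := hc.tendsto 0
    rw [zero_smul, add_zero] at this
    exact this.eventually (h.eventually hH)
  obtain ⟨t, ht1, ht2⟩ := (h1.and h2).exists
  exact ⟨p + t • q, ht2, by rw [← heval] at ht1; exact ht1⟩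

/-- Subtracting a multiple of the field makes a flex vanish on the old vertices, so only its value
at `v` is left to control. -/
lemma IsRigid.extend (h : H'.IsRigid M g' p) (hV : ∀ a ∈ H.V, a = v ∨ a ∈ H'.V)
    (hflex : ∀ u, H.IsFlex σ g p u → H'.IsFlex σ g' p u)
    (hv : ∀ w, H.IsFlex σ g p w → (∀ a ∈ H'.V, w a = 0) → w v = 0) : H.IsRigid M g p := by
  intro u hu
  obtain ⟨c, hc⟩ := h u (hflex u hu)
  have h1 := hv _ (hu.sub_smul_field M c) fun a ha => by simp [hc a ha]
  refine ⟨c, fun a ha => ?_⟩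
  rcases hV a ha with rfl | ha
  · simpa [sub_eq_zero] using h1
  · exact hc a ha

end FinMultigraph

/-! ### Placements in general position. -/

namespace SymmetricMotion

variable {σ : Plane ≃ₗᵢ[ℝ] Plane} {α : Type*} {a b c : α}

/-- The points `p a`, `γ p b`, `δ p c` are affinely independent for some placement `p`. -/
lemma exists_cross_ne_zero_of_ne (M : SymmetricMotion σ) {γ δ : Bool} (hab : a ≠ b) (hac : a ≠ c)
    (hbc : b = c → γ ≠ δ) :
    ∃ q : α → Plane, cross (twist σ γ (q b) - q a) (twist σ δ (q c) - q a) ≠ 0 := by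
  classical
  obtain ⟨z, hz⟩ := M.exists_ne
  obtain ⟨f, hf⟩ : ∃ f : α → Plane, twist σ δ (f c) - twist σ γ (f b) ≠ 0 := by
    by_cases h : b = c
    · subst h
      refine ⟨fun _ => z, ?_⟩
      have := hbc rfl
      cases γ <;> cases δ <;> simp_all [sub_eq_zero, Ne.symm hz]
    · refine ⟨fun x => if x = b then 0 else z, ?_⟩
      have hz0 : z ≠ 0 := by rintro rfl; simp at hz
      simp [Ne.symm h, hz0]
  obtain ⟨y, hy⟩ := Plane.exists_cross_ne_zero hf
  -- This makes the first vector `y`; the second exceeds it by the nonzero vector of `hf`, which is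
  -- independent of `y`.
  refine ⟨Function.update f a (twist σ γ (f b) - y), ?_⟩
  rw [Function.update_self, Function.update_of_ne hab.symm, Function.update_of_ne hac.symm]
  intro h
  apply hy
  simp only [cross, PiLp.sub_apply] at *
  linear_combination -h

lemma exists_cross_ne_zero_of_loop (M : SymmetricMotion σ) (δ : Bool) (hac : a ≠ c) :
    ∃ q : α → Plane, cross (twist σ true (q a) - q a) (twist σ δ (q c) - q a) ≠ 0 := by
  classical
  obtain ⟨z, hz⟩ := M.exists_ne
  obtain ⟨y, hy⟩ := Plane.exists_cross_ne_zero (sub_ne_zero.2 hz)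
  refine ⟨fun x => if x = a then z else twist σ δ (z + y), ?_⟩
  simpa only [if_true, twist_true_apply, hac.symm, if_false, M.twist_twist, add_sub_cancel_left] using hy

end SymmetricMotion

/-! ### Vertex extensions and the induction. -/

namespace FinMultigraph

open Finset

variable {α β : Type*} {H H' : FinMultigraph α β} {σ : Plane ≃ₗᵢ[ℝ] Plane} {g g' : β → Bool}
  {p u w : α → Plane} {v a b c : α} {e₁ e₂ e₃ : β} {M : SymmetricMotion σ}

lemma IsGain.extend (h : H'.IsGain g')
    (h1 : ∀ e ∈ H.E, v ∉ H.ends e → e ∈ H'.E ∧ H'.ends e = H.ends e ∧ g e = g' e)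
    (h2 : ∀ e ∈ H.E, ∀ e' ∈ H.E, v ∈ H.ends e → v ∈ H.ends e' → e ≠ e' → H.ends e = H.ends e' →
      g e ≠ g e')
    (h3 : ∀ e ∈ H.E, H.ends e = s(v, v) → g e = true) : H.IsGain g where
  ne e he e' he' hne hends := by
    by_cases hv : v ∈ H.ends e
    · exact h2 e he e' he' hv (hends ▸ hv) hne hends
    · obtain ⟨h4, h5, h6⟩ := h1 e he hv
      obtain ⟨h7, h8, h9⟩ := h1 e' he' (hends ▸ hv)
      rw [h6, h9]
      exact h.ne e h4 e' h7 hne (by rw [h5, h8, hends])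
  loop e he a ha := by
    by_cases hv : v ∈ H.ends e
    · have : v = a := by simpa [ha] using hv
      exact h3 e he (this ▸ ha)
    · obtain ⟨h4, h5, h6⟩ := h1 e he hv
      rw [h6]
      exact h.loop e h4 a (by rw [h5, ha])

lemma IsFlex.inner_eq_zero (h : H.IsFlex σ g p w) {e : β} (he : e ∈ H.E) (hends : H.ends e = s(v, a))
    (ha : w a = 0) : ⟪twist σ (g e) (p a) - p v, w v⟫_ℝ = 0 := by
  have := h e he v a hends
  rwa [ha, map_zero, sub_zero, ← neg_eq_zero, ← inner_neg_left, neg_sub] at this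

/-- The involutive isometry `twist σ (g e)` is self-adjoint, so the loop condition is twice a linear
condition on `w v`, of the same form as for an edge to a fixed point. -/
lemma IsFlex.inner_eq_zero_of_loop (M : SymmetricMotion σ) (h : H.IsFlex σ g p w) {e : β}
    (he : e ∈ H.E) (hends : H.ends e = s(v, v)) : ⟪twist σ (g e) (p v) - p v, w v⟫_ℝ = 0 := by
  have h1 := h e he v v hends
  have h2 : ⟪twist σ (g e) (p v), twist σ (g e) (w v)⟫_ℝ = ⟪p v, w v⟫_ℝ :=
    (twist σ (g e)).inner_map_map _ _
  have h3 : ⟪twist σ (g e) (p v), w v⟫_ℝ = ⟪p v, twist σ (g e) (w v)⟫_ℝ := by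
    rw [← (twist σ (g e)).inner_map_map, M.twist_twist]
  simp only [inner_sub_left, inner_sub_right] at *
  linarith

/-- The graph is a single loop, and `exists_span` supplies the point. -/
lemma IsTight.exists_isRigid_of_card_eq_one (ht : H.IsTight) (M : SymmetricMotion σ)
    (hV : #H.V = 1) : ∃ g, H.IsGain g ∧ ∃ p, H.IsRigid M g p := by
  have hE := ht.card_eq
  obtain ⟨v, hv⟩ := card_eq_one.1 hV
  obtain ⟨e, he⟩ := card_eq_one.1 (show #H.E = 1 by omega)
  have hends : H.ends e = s(v, v) := by
    have := ht.ends_mem e (by simp [he])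
    induction hx : H.ends e with | _ a b
    rw [hx, hv] at this
    simp at this
    rw [this.1, this.2]
  obtain ⟨q, hq⟩ := M.exists_span
  refine ⟨fun _ => true, ⟨fun e' he' e'' he'' hne => ?_, fun _ _ _ _ => rfl⟩, fun _ => q,
    fun u hu => ?_⟩
  · rw [he, mem_singleton] at he' he''
    exact absurd (he'.trans he''.symm) hne
  · obtain ⟨c, hc⟩ := hq (u v) (hu e (by simp [he]) v v hends)
    exact ⟨c, by simpa only [hv, mem_singleton, forall_eq, SymmetricMotion.field] using hc⟩

lemma IsTight.exists_isRigid_of_card_star_eq_two [Fintype α] (ht : H.IsTight)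
    (M : SymmetricMotion σ) (hv : v ∈ H.V) (hV : 2 ≤ #H.V) (hs : #(H.star v) = 2)
    (hl : #(H.parallel v v) ≤ 1)
    (ih : (H.deleteVertex v).IsTight →
      ∃ g, (H.deleteVertex v).IsGain g ∧ ∃ p, (H.deleteVertex v).IsRigid M g p) :
    ∃ g, H.IsGain g ∧ ∃ p, H.IsRigid M g p := by
  classical
  have ht' := ht.deleteVertex hv hs hV
  obtain ⟨g', hg', p₀, hp₀⟩ := ih ht'
  have hkey : ∀ e₁ e₂ a b, e₁ ≠ e₂ → H.star v = {e₁, e₂} → H.ends e₁ = s(v, a) →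
      H.ends e₂ = s(v, b) → v ≠ b → ∃ g, H.IsGain g ∧ ∃ p, H.IsRigid M g p := by
    intro e₁ e₂ a b hne hstar h1 h2 hvb
    have he₁ : e₁ ∈ H.E := (mem_star.1 (by rw [hstar]; simp : e₁ ∈ H.star v)).1
    have he₂ : e₂ ∈ H.E := (mem_star.1 (by rw [hstar]; simp : e₂ ∈ H.star v)).1
    have hmem : ∀ e ∈ H.E, v ∈ H.ends e → e = e₁ ∨ e = e₂ := fun e he hve => by
      have : e ∈ H.star v := mem_star.2 ⟨he, hve⟩
      simpa [hstar] using this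
    have hbV : b ∈ (H.deleteVertex v).V :=
      mem_erase.2 ⟨hvb.symm, ht.ends_mem e₂ he₂ b (by simp [h2])⟩
    have haV : a ≠ v → a ∈ (H.deleteVertex v).V := fun hav =>
      mem_erase.2 ⟨hav, ht.ends_mem e₁ he₁ a (by simp [h1])⟩
    -- A loop must have gain `true`; if the two edges are parallel, they get distinct gains.
    set γ : Bool := decide (v = a) with hγ
    set δ : Bool := decide (a = b) with hδ
    have hq : ∃ q : α → Plane, cross (twist σ γ (q a) - q v) (twist σ δ (q b) - q v) ≠ 0 := by
      by_cases hva : v = a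
      · subst hva
        rw [hγ, decide_eq_true rfl]
        exact M.exists_cross_ne_zero_of_loop δ hvb
      · refine M.exists_cross_ne_zero_of_ne hva hvb fun hab => ?_
        rw [hγ, hδ, decide_eq_false hva, decide_eq_true hab]
        exact Bool.false_ne_true
    obtain ⟨q, hq⟩ := hq
    -- The position of `v` may move as well, since rigidity of the smaller graph does not depend on
    -- it.
    obtain ⟨p, hp, hcross⟩ := hp₀.exists_cross_ne_zero ht'.ends_mem γ δ v a b q hq
    let g : β → Bool := fun e => if e = e₁ then γ else if e = e₂ then δ else g' e
    have g1 : g e₁ = γ := by simp [g]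
    have g2 : g e₂ = δ := by simp [g, hne.symm]
    have gE : ∀ e ∈ (H.deleteVertex v).E, g e = g' e := by
      intro e he
      simp only [FinMultigraph.deleteVertex, mem_sdiff, hstar, mem_insert, mem_singleton,
        not_or] at he
      simp [g, he.2.1, he.2.2]
    refine ⟨g, hg'.extend (v := v) (fun e he hve => ?_) (fun e he e' he' hve hve' hee hends => ?_)
      (fun e he hends => ?_), p, hp.extend (v := v) (fun x hx => ?_) (fun u hu e he x y hxy => ?_)
      (fun w hw hw0 => ?_)⟩
    · have he' : e ∈ (H.deleteVertex v).E := mem_sdiff.2 ⟨he, fun h => hve (mem_star.1 h).2⟩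
      exact ⟨he', rfl, gE e he'⟩
    · have hab : H.ends e₁ = H.ends e₂ → g e₁ ≠ g e₂ := by
        rw [h1, h2, g1, g2, hγ, hδ]
        intro h
        have : a = b := Sym2.congr_right.1 h
        subst this
        simp [hvb]
      rcases hmem e he hve with rfl | rfl <;> rcases hmem e' he' hve' with rfl | rfl
      · exact absurd rfl hee
      · exact hab hends
      · exact (hab hends.symm).symm
      · exact absurd rfl hee
    · rcases hmem e he (by simp [hends]) with rfl | rfl
      · rw [g1, hγ]
        have : a = v := by simpa [h1] using hends
        simp [this]
      · exact absurd (by simpa [h2] using hends : b = v) hvb.symm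
    · by_cases hxv : x = v
      · exact Or.inl hxv
      · exact Or.inr (mem_erase.2 ⟨hxv, hx⟩)
    · rw [← gE e he]
      exact hu e (mem_sdiff.1 he).1 x y hxy
    · refine eq_zero_of_inner_eq_zero hcross ?_ ?_
      · by_cases hva : v = a
        · subst hva
          rw [← g1]
          exact hw.inner_eq_zero_of_loop M he₁ h1
        · rw [← g1]
          exact hw.inner_eq_zero he₁ h1 (hw0 a (haV (Ne.symm hva)))
      · rw [← g2]
        exact hw.inner_eq_zero he₂ h2 (hw0 b hbV)
  obtain ⟨e₁, e₂, hne, hstar⟩ := card_eq_two.1 hs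
  have hends : ∀ e ∈ H.star v, ∃ a, H.ends e = s(v, a) := fun e he => by
    obtain ⟨a, ha⟩ := (mem_star.1 he).2
    exact ⟨a, ha⟩
  obtain ⟨a, ha⟩ := hends e₁ (by simp [hstar])
  obtain ⟨b, hb⟩ := hends e₂ (by simp [hstar])
  by_cases hvb : v = b
  · refine hkey e₂ e₁ b a hne.symm (by rw [hstar, pair_comm]) hb ha ?_
    rintro rfl
    subst hvb
    have : H.star v ⊆ H.parallel v v := by
      intro e he
      refine mem_parallel.2 ⟨(mem_star.1 he).1, ?_⟩
      rw [hstar] at he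
      simp only [mem_insert, mem_singleton] at he
      rcases he with rfl | rfl <;> assumption
    have := card_le_card this
    omega
  · exact hkey e₁ e₂ a b hne hstar ha hb hvb

lemma IsTripod.exists_isRigid [Fintype α] (h : H.IsTripod v e₁ e₂ e₃ a b c) (ht : H.IsTight)
    (M : SymmetricMotion σ) (hbc : b ≠ c)
    (hg' : (H.reduce v e₁ e₂ e₃ a b).IsGain g') {p₀ : α → Plane}
    (ht' : (H.reduce v e₁ e₂ e₃ a b).IsTight)
    (hp₀ : (H.reduce v e₁ e₂ e₃ a b).IsRigid M g' p₀) :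
    ∃ g, H.IsGain g ∧ ∃ p, H.IsRigid M g p := by
  classical
  obtain ⟨hv, ha, hb, hc⟩ := h.mem_V ht
  have he₁ : e₁ ∈ (H.reduce v e₁ e₂ e₃ a b).E := by
    simp [FinMultigraph.reduce, h.mem₁, h.ne₁₂, h.ne₁₃]
  have hends₁ : (H.reduce v e₁ e₂ e₃ a b).ends e₁ = s(a, b) := by simp [FinMultigraph.reduce]
  -- The edge `e₁` will get gain `false` and `e₂` the gain of the replaced edge `ab`, which is
  -- `true` if that is a loop. This separates `e₁` from `e₂` when `a = b`, and `δ` separates `e₁`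
  -- from `e₃` when `a = c`.
  set γ : Bool := g' e₁ with hγ
  set δ : Bool := decide (a = c) with hδ
  have hγt : a = b → γ = true := by
    rintro rfl
    exact hg'.loop e₁ he₁ a hends₁
  have hq : ∃ q : α → Plane, cross (twist σ γ (q b) - q a) (twist σ δ (q c) - q a) ≠ 0 := by
    by_cases hab : a = b
    · rw [hγt hab]
      subst hab
      exact M.exists_cross_ne_zero_of_loop δ hbc
    by_cases hac : a = c
    · subst hac
      obtain ⟨q, hq⟩ := M.exists_cross_ne_zero_of_loop γ hab
      refine ⟨q, ?_⟩
      rw [cross_swap, hδ, decide_eq_true rfl, neg_ne_zero]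
      exact hq
    · exact M.exists_cross_ne_zero_of_ne hab hac fun h => absurd h hbc
  obtain ⟨q, hq⟩ := hq
  obtain ⟨p₁, hp₁, hcross⟩ := hp₀.exists_cross_ne_zero ht'.ends_mem γ δ a b c q hq
  let g : β → Bool := fun e => if e = e₁ then false else if e = e₂ then γ else
    if e = e₃ then δ else g' e
  have g1 : g e₁ = false := by simp [g]
  have g2 : g e₂ = γ := by simp [g, h.ne₁₂.symm]
  have g3 : g e₃ = δ := by simp [g, h.ne₁₃.symm, h.ne₂₃.symm]
  -- Chosen so that `p v - p a = p a - γ (p b)` and `p v - γ (p b) = 2 (p a - γ (p b))`: the bars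
  -- `e₁`, `e₂` are parallel to the bar `ab`, and the difference of their conditions yields its
  -- condition.
  let p : α → Plane := Function.update p₁ v ((2 : ℝ) • p₁ a - twist σ γ (p₁ b))
  have pv : p v = (2 : ℝ) • p₁ a - twist σ γ (p₁ b) := by simp [p]
  have pne : ∀ x, x ≠ v → p x = p₁ x := fun x hx => by simp [p, hx]
  have hV' : ∀ x, x ≠ v → x ∈ H.V → x ∈ (H.reduce v e₁ e₂ e₃ a b).V := fun x hx hxV =>
    mem_erase.2 ⟨hx, hxV⟩
  have hp : (H.reduce v e₁ e₂ e₃ a b).IsRigid M g' p := hp₁.congr ht'.ends_mem fun x hx =>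
    (pne x (mem_erase.1 hx).1).symm
  refine ⟨g, hg'.extend (v := v) (fun e he hve => ?_) (fun e he e' he' hve hve' hee hends => ?_)
    (fun e he hends => ?_), p, hp.extend (v := v) (fun x hx => ?_) (fun u hu e he x y hxy => ?_)
    (fun w hw hw0 => ?_)⟩
  · have n1 : e ≠ e₁ := by rintro rfl; simp [h.ends₁] at hve
    have n2 : e ≠ e₂ := by rintro rfl; simp [h.ends₂] at hve
    have n3 : e ≠ e₃ := by rintro rfl; simp [h.ends₃] at hve
    exact ⟨by simp [FinMultigraph.reduce, he, n2, n3], by simp [FinMultigraph.reduce, n1],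
      by simp [g, n1, n2, n3]⟩
  · have h12 : H.ends e₁ = H.ends e₂ → g e₁ ≠ g e₂ := by
      rw [h.ends₁, h.ends₂, g1, g2]
      intro hh
      rw [hγt (Sym2.congr_right.1 hh)]
      simp
    have h13 : H.ends e₁ = H.ends e₃ → g e₁ ≠ g e₃ := by
      rw [h.ends₁, h.ends₃, g1, g3, hδ]
      intro hh
      simp [Sym2.congr_right.1 hh]
    have h23 : H.ends e₂ ≠ H.ends e₃ := by
      rw [h.ends₂, h.ends₃]
      exact fun hh => hbc (Sym2.congr_right.1 hh)
    rcases h.mem_star e he hve with rfl | rfl | rfl <;>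
      rcases h.mem_star e' he' hve' with rfl | rfl | rfl
    · exact absurd rfl hee
    · exact h12 hends
    · exact h13 hends
    · exact (h12 hends.symm).symm
    · exact absurd rfl hee
    · exact absurd hends h23
    · exact (h13 hends.symm).symm
    · exact absurd hends.symm h23
    · exact absurd rfl hee
  · rcases h.mem_star e he (by simp [hends]) with rfl | rfl | rfl
    · exact absurd (by simpa [h.ends₁] using hends) h.ne_a
    · exact absurd (by simpa [h.ends₂] using hends) h.ne_b
    · exact absurd (by simpa [h.ends₃] using hends) h.ne_c
  · by_cases hxv : x = v
    · exact Or.inl hxv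
    · exact Or.inr (hV' x hxv hx)
  · by_cases hee : e = e₁
    · subst hee
      have f1 := hu e h.mem₁ v a h.ends₁
      have f2 := hu e₂ h.mem₂ v b h.ends₂
      rw [g1, pv, pne a h.ne_a] at f1
      rw [g2, pv, pne b h.ne_b] at f2
      simp only [twist_false_apply] at f1
      have hab0 : ⟪p a - twist σ γ (p b), u a - twist σ γ (u b)⟫_ℝ = 0 := by
        rw [pne a h.ne_a, pne b h.ne_b]
        rw [show (2 : ℝ) • p₁ a - twist σ γ (p₁ b) - p₁ a = p₁ a - twist σ γ (p₁ b) by module]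
          at f1
        rw [show (2 : ℝ) • p₁ a - twist σ γ (p₁ b) - twist σ γ (p₁ b)
          = (2 : ℝ) • (p₁ a - twist σ γ (p₁ b)) by module, inner_smul_left] at f2
        simp only [conj_trivial] at f2
        rw [show u a - twist σ γ (u b) = (u v - twist σ γ (u b)) - (u v - u a) by abel,
          inner_sub_right, f1]
        linarith
      rw [hends₁] at hxy
      rcases Sym2.eq_iff.1 hxy with ⟨rfl, rfl⟩ | ⟨rfl, rfl⟩
      · exact hab0
      · rw [M.inner_sub_twist]
        exact hab0
    · simp only [FinMultigraph.reduce, mem_sdiff, mem_insert, mem_singleton, not_or,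
        Function.update_of_ne hee] at he hxy
      have := hu e he.1 x y hxy
      simpa only [g, hee, he.2.1, he.2.2, if_false] using this
  · have r1 := hw.inner_eq_zero h.mem₁ h.ends₁ (hw0 a (hV' a h.ne_a ha))
    have r3 := hw.inner_eq_zero h.mem₃ h.ends₃ (hw0 c (hV' c h.ne_c hc))
    refine eq_zero_of_inner_eq_zero (fun h0 => hcross ?_) r1 r3
    -- The first vector is `γ (p b) - p a`, and the second is `δ (p c) - p a` plus the first, so the
    -- determinant is that of `hcross`.
    rw [g1, g3, pv, pne a h.ne_a, pne c h.ne_c] at h0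
    simp only [twist_false_apply, cross, PiLp.sub_apply, PiLp.smul_apply,
      smul_eq_mul] at h0 ⊢
    linear_combination h0

/-- Every `(2, 1)`-tight multigraph without triples of parallel edges has a rigid gain graph. -/
theorem IsTight.exists_isRigid [Fintype α] (ht : H.IsTight) (M : SymmetricMotion σ) :
    ∃ g, H.IsGain g ∧ ∃ p, H.IsRigid M g p := by
  classical
  induction hn : #H.V using Nat.strong_induction_on generalizing H with
  | _ n ih =>
  have hpos := ht.nonempty.card_pos
  by_cases h1 : #H.V = 1
  · exact ht.exists_isRigid_of_card_eq_one M h1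
  have h2 : 2 ≤ #H.V := by omega
  obtain ⟨v, hv, hdeg⟩ := ht.exists_card_star_add_le
  have hstar := ht.two_le_card_star hv h2
  have hlt : #(H.V.erase v) < n := hn ▸ card_erase_lt_of_mem hv
  by_cases h3 : #(H.star v) = 2
  · exact ht.exists_isRigid_of_card_star_eq_two M hv h2 h3 (by omega) fun ht' => ih _ hlt ht' rfl
  · obtain ⟨e₁, e₂, e₃, h12, h13, h23, hst⟩ := card_eq_three.1 (show #(H.star v) = 3 by omega)
    have hloop : ∀ e, e ∉ H.parallel v v := by
      have : H.parallel v v = ∅ := card_eq_zero.1 (by omega)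
      simp [this]
    have hends : ∀ e ∈ H.star v, ∃ a, H.ends e = s(v, a) ∧ a ≠ v := fun e he => by
      obtain ⟨heE, a, ha⟩ := mem_star.1 he
      refine ⟨a, ha, fun hav => ?_⟩
      rw [hav] at ha
      exact hloop e (mem_parallel.2 ⟨heE, ha⟩)
    have hmem : ∀ e ∈ H.star v, e ∈ H.E := fun e he => (mem_star.1 he).1
    obtain ⟨a, ha, hav⟩ := hends e₁ (by simp [hst])
    obtain ⟨b, hb, hbv⟩ := hends e₂ (by simp [hst])
    obtain ⟨c, hc, hcv⟩ := hends e₃ (by simp [hst])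
    have htri : H.IsTripod v e₁ e₂ e₃ a b c :=
      { mem_star := fun e he hve => by
          have : e ∈ H.star v := mem_star.2 ⟨he, hve⟩
          simpa [hst] using this
        mem₁ := hmem _ (by simp [hst])
        mem₂ := hmem _ (by simp [hst])
        mem₃ := hmem _ (by simp [hst])
        ne₁₂ := h12, ne₁₃ := h13, ne₂₃ := h23, ends₁ := ha, ends₂ := hb, ends₃ := hc
        ne_a := hav, ne_b := hbv, ne_c := hcv }
    obtain ⟨e₁, e₂, e₃, a, b, c, htri, hbc, hadm⟩ := htri.exists_admissible ht
    have ht' := ht.reduce htri hadm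
    obtain ⟨g', hg', p₀, hp₀⟩ := ih _ hlt ht' rfl
    exact htri.exists_isRigid ht M hbc hg' ht' hp₀

end FinMultigraph

/-! ### Existence of the symmetric motion. -/

namespace Plane

lemma cross_ne_zero_of_inner_eq_zero {x y : Plane} (hx : x ≠ 0) (hy : y ≠ 0)
    (h : ⟪x, y⟫_ℝ = 0) : cross x y ≠ 0 := by
  intro hc
  apply hx
  rw [inner_eq] at h
  have h1 : ⟪y, y⟫_ℝ ≠ 0 := by simpa using hy
  rw [inner_eq] at h1
  simp only [cross] at hc
  apply ext_coord <;> apply mul_left_cancel₀ h1 <;> simp only [PiLp.zero_apply]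
  · linear_combination y 0 * h + y 1 * hc
  · linear_combination y 1 * h - y 0 * hc

lemma exists_skew_matrix (T : Plane →L[ℝ] Plane) (hT : ∀ z, ⟪z, T z⟫_ℝ = 0) :
    ∃ A : Matrix (Fin 2) (Fin 2) ℝ, A.transpose = -A ∧ ∀ z, Matrix.toEuclideanLin A z = T z := by
  set e₀ : Plane := !₂[1, 0] with he₀
  set e₁ : Plane := !₂[0, 1] with he₁
  have h0 := hT e₀
  have h1 := hT e₁
  -- The diagonal entries vanish by `h0` and `h1`; polarisation gives the off-diagonal relation.
  have h2 := hT (e₀ + e₁)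
  simp only [inner_eq, map_add, PiLp.add_apply] at h0 h1 h2
  simp [he₀, he₁] at h0 h1 h2
  rw [← he₀, ← he₁] at h2
  rw [← he₀] at h0
  rw [← he₁] at h1
  refine ⟨!![T e₀ 0, T e₁ 0; T e₀ 1, T e₁ 1], ?_, fun z => ?_⟩
  · ext i j
    fin_cases i <;> fin_cases j <;> simp <;> linarith
  · have hz : z = z 0 • e₀ + z 1 • e₁ := by
      apply ext_coord <;> simp [he₀, he₁]
    conv_rhs => rw [hz]
    apply ext_coord <;> simp [Matrix.toLpLin_apply, dotProduct, Fin.sum_univ_two] <;>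
      ring

end Plane

/-- A nontrivial linear involution is the half-turn or a reflection in a line. -/
lemma SymmetricMotion.nonempty (σ : Plane ≃ₗᵢ[ℝ] Plane) (hσ : ∀ z, σ (σ z) = z)
    (hne : ∃ q, σ q ≠ q) : Nonempty (SymmetricMotion σ) := by
  by_cases hneg : ∀ z, σ z = -z
  -- For the half-turn, the bar from (1, 0) to (-1, 0) forces `u 0 = 0`, and the rotation moves (1,
  -- 0) along (0, 1).
  · refine ⟨{ T := (Matrix.toEuclideanLin !![0, -1; 1, 0]).toContinuousLinearMap
              x := 0
              invol := hσ
              inner_T := fun z => ?_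
              T_comm := fun z => by rw [hneg, hneg, map_neg]
              fix_x := map_zero σ
              exists_span := ⟨!₂[1, 0], fun u hu => ⟨u 1, ?_⟩⟩
              exists_ne := hne }⟩
    · simp [inner_eq, Matrix.toLpLin_apply, dotProduct, Fin.sum_univ_two]
      ring
    · simp [hneg, inner_eq] at hu
      apply ext_coord <;>
        simp [Matrix.toLpLin_apply]
      linarith
  · push Not at hneg
    obtain ⟨y, hy⟩ := hneg
    obtain ⟨q, hq⟩ := hne
    -- For a reflection, `f` spans the mirror and `n` is normal to it. The bar from `n` to `-n`
    -- forces `u` to be orthogonal to `n`, hence a multiple of `f`.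
    set f := y + σ y with hf
    set n := q - σ q with hn
    have hf0 : f ≠ 0 := fun h => hy (eq_neg_of_add_eq_zero_right h)
    have hn0 : n ≠ 0 := fun h => hq (sub_eq_zero.1 h).symm
    have hσf : σ f = f := by rw [hf, map_add, hσ, add_comm]
    have hσn : σ n = -n := by rw [hn, map_sub, hσ, neg_sub]
    have anti : ∀ u, ⟪n, σ u⟫_ℝ = -⟪n, u⟫_ℝ := fun u => by
      rw [← σ.inner_map_map, hσ, hσn, inner_neg_left]
    have hnf : ⟪n, f⟫_ℝ = 0 := by
      have := anti f
      rw [hσf] at this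
      linarith
    have hff : ⟪f, f⟫_ℝ ≠ 0 := by simpa using hf0
    refine ⟨{ T := 0
              x := f
              invol := hσ
              inner_T := by simp
              T_comm := by simp
              fix_x := hσf
              exists_span := ⟨n, fun u hu => ⟨⟪f, u⟫_ℝ / ⟪f, f⟫_ℝ, ?_⟩⟩
              exists_ne := ⟨q, hq⟩ }⟩
    have hu' : ⟪n, u⟫_ℝ = 0 := by
      rw [hσn, inner_sub_right, sub_neg_eq_add, inner_add_left, inner_add_left, anti] at hu
      linarith
    rw [zero_apply, zero_add, ← sub_eq_zero]
    refine eq_zero_of_inner_eq_zero (cross_ne_zero_of_inner_eq_zero hn0 hf0 hnf) ?_ ?_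
    · rw [inner_sub_right, inner_smul_right, hu', hnf, mul_zero, sub_zero]
    · rw [inner_sub_right, inner_smul_right, div_mul_cancel₀ _ hff, sub_self]

/-! ### Translation to `Graph` and the orbit rigidity matrix. -/

namespace Graph

variable {α β : Type*} {G : Graph α β}

lemma exists_ends (G : Graph α β) (e : E(G)) :
    ∃ z : Sym2 V(G), ∀ a b : V(G), z = s(a, b) ↔ G.IsLink e a b := by
  obtain ⟨x, y, h⟩ := G.exists_isLink_of_mem_edgeSet e.2
  refine ⟨s(⟨x, h.left_mem⟩, ⟨y, h.right_mem⟩), fun a b => ?_⟩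
  rw [h.isLink_iff, Sym2.eq_iff]
  simp only [Subtype.ext_iff]

/-- The finite multigraph with the vertices and edges of `G`. -/
noncomputable def toFinMultigraph (G : Graph α β) [Fintype V(G)] [Fintype E(G)] :
    FinMultigraph V(G) E(G) where
  V := Finset.univ
  E := Finset.univ
  ends e := (G.exists_ends e).choose

section

variable [Fintype V(G)] [Fintype E(G)]

lemma toFinMultigraph_ends_eq_iff {e : E(G)} {a b : V(G)} :
    G.toFinMultigraph.ends e = s(a, b) ↔ G.IsLink e a b :=
  (G.exists_ends e).choose_spec a b

lemma inducedEdgeCount_image (X : Finset V(G)) :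
    G.inducedEdgeCount ((↑) '' (X : Set V(G))) = (G.toFinMultigraph.ind X).card := by
  have : E(G.induce ((↑) '' (X : Set V(G)))) =
      ((↑) : E(G) → β) '' (G.toFinMultigraph.ind X : Set E(G)) := by
    ext e
    simp only [edgeSet_induce, Set.mem_ofPred_eq, Set.mem_image, Finset.mem_coe]
    constructor
    · rintro ⟨_, _, h, ⟨x, hx, rfl⟩, ⟨y, hy, rfl⟩⟩
      refine ⟨⟨e, h.edge_mem⟩, FinMultigraph.mem_ind.2 ⟨Finset.mem_univ _, ?_⟩, rfl⟩
      rw [(toFinMultigraph_ends_eq_iff (e := ⟨e, h.edge_mem⟩)).2 h]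
      simp [hx, hy]
    · rintro ⟨e, he, rfl⟩
      have h := (FinMultigraph.mem_ind.1 he).2
      induction hz : G.toFinMultigraph.ends e with | _ x y
      rw [hz] at h
      exact ⟨x, y, toFinMultigraph_ends_eq_iff.1 hz, ⟨x, h x (by simp), rfl⟩,
        ⟨y, h y (by simp), rfl⟩⟩
  rw [inducedEdgeCount, this, Set.ncard_image_of_injective _ Subtype.val_injective,
    Set.ncard_coe_finset]

lemma IsTight.toFinMultigraph (h : G.IsTight 2 1) (htriple : ¬ G.HasParallelTriple) :
    G.toFinMultigraph.IsTight where
  ends_mem _ _ _ _ := Finset.mem_univ _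
  card_eq := by
    have := h.2
    rw [← Nat.card_coe_set_eq, ← Nat.card_coe_set_eq, Nat.card_eq_fintype_card,
      Nat.card_eq_fintype_card] at this
    simp only [Graph.toFinMultigraph, Finset.card_univ]
    push_cast at this
    omega
  sparse X _ hX := by
    have := h.1 ((↑) '' (X : Set V(G))) (by simp) (by simpa using hX)
    rw [inducedEdgeCount_image, Set.ncard_image_of_injective _ Subtype.val_injective,
      Set.ncard_coe_finset] at this
    push_cast at this
    omega
  parallel_le a b hab := by
    by_contra! hc
    obtain ⟨e₁, h₁, e₂, h₂, e₃, h₃, h12, h13, h23⟩ := Finset.two_lt_card.1 hc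
    simp only [FinMultigraph.mem_parallel, toFinMultigraph_ends_eq_iff] at h₁ h₂ h₃
    exact htriple ⟨a, b, e₁, e₂, e₃, Subtype.coe_ne_coe.2 hab, Subtype.coe_ne_coe.2 h12,
      Subtype.coe_ne_coe.2 h13, Subtype.coe_ne_coe.2 h23, h₁.2, h₂.2, h₃.2⟩

variable {Γ : Subgroup (Plane ≃ₗᵢ[ℝ] Plane)} {s : Γ}

open scoped Classical in
/-- The gain map with values in `{1, s}` described by Boolean gains. -/
noncomputable def gainMapOfBool (g : E(G) → Bool) (hg : G.toFinMultigraph.IsGain g)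
    (hs : s ≠ 1) (hss : s * s = 1) : G.GainMap Γ where
  -- Both orientations get the same value, because `s` is its own inverse.
  toFun e _ _ := if h : e ∈ E(G) then if g ⟨e, h⟩ then s else 1 else 1
  inv_eq e v w h _ := by
    have : s⁻¹ = s := inv_eq_of_mul_eq_one_left hss
    split_ifs <;> simp [this]
  ne_of_ne e e' v w hne h h' := by
    rw [dif_pos h.edge_mem, dif_pos h'.edge_mem]
    have h1 := hg.ne ⟨e, h.edge_mem⟩ (Finset.mem_univ _) ⟨e', h'.edge_mem⟩ (Finset.mem_univ _)
      (by simpa using hne) (by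
        rw [toFinMultigraph_ends_eq_iff.2 (show G.IsLink (⟨e, h.edge_mem⟩ : E(G))
            (⟨v, h.left_mem⟩ : V(G)) (⟨w, h.right_mem⟩ : V(G)) from h),
          toFinMultigraph_ends_eq_iff.2 (show G.IsLink (⟨e', h'.edge_mem⟩ : E(G))
            (⟨v, h.left_mem⟩ : V(G)) (⟨w, h.right_mem⟩ : V(G)) from h')])
    cases h2 : g ⟨e, h.edge_mem⟩ <;> cases h3 : g ⟨e', h'.edge_mem⟩ <;>
      simp_all [Ne.symm hs]
  loop_ne_one e v h := by
    have h1 := hg.loop ⟨e, h.edge_mem⟩ (Finset.mem_univ _) ⟨v, h.vertex_mem⟩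
      (toFinMultigraph_ends_eq_iff.2 h)
    simp [h.edge_mem, h1, hs]

lemma gainMapOfBool_apply {g : E(G) → Bool} (hg : G.toFinMultigraph.IsGain g)
    (hs : s ≠ 1) (hss : s * s = 1) (e : E(G)) (v w : α) (z : Plane) :
    ((gainMapOfBool g hg hs hss).toFun e v w).1 z = twist s.1 (g e) z := by
  cases h : g e <;> simp [gainMapOfBool, h]

end

/-- The rows of the orbit rigidity matrix as linear forms. -/
lemma GainMap.IsFlex.inner_eq_zero [Fintype V(G)]
    {Γ : Subgroup (Plane ≃ₗᵢ[ℝ] Plane)} {φ : G.GainMap Γ} {p u : V(G) → Plane} (h : φ.IsFlex p u)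
    (hinv : ∀ γ : Γ, γ⁻¹ = γ) {e : E(G)} {a b : V(G)} (hab : G.IsLink e a b) :
    ⟪p a - (φ.toFun e a b).1 (p b), u a - (φ.toFun e a b).1 (u b)⟫_ℝ = 0 := by
  classical
  -- The row of `e`, cut into one vector per vertex.
  let r : V(G) → Plane := fun v =>
    if G.IsLoopAt e v then (2 : ℝ) • p v - (φ.toFun e v v).1 (p v) - (φ.toFun e v v)⁻¹.1 (p v)
    else if h : G.Inc e v then
      p v - (φ.toFun e v h.other).1 (p ⟨h.other, h.inc_other.vertex_mem⟩)
    else 0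
  have hr : ∑ v, ⟪r v, u v⟫_ℝ = 0 := by
    have h1 := congrFun h e
    simp only [Matrix.mulVec, dotProduct, Fintype.sum_prod_type, Pi.zero_apply] at h1
    rw [← h1]
    refine Finset.sum_congr rfl fun v _ => ?_
    rw [inner_eq, Fin.sum_univ_two]
    congr 2 <;>
    · simp only [r, orbitRigidityMatrix, Matrix.of_apply]
      split_ifs <;> rfl
  have hinvol : ∀ (γ : Γ) (z : Plane), γ.1 (γ.1 z) = z := by
    intro γ z
    have h1 : γ * γ = 1 := by
      nth_rw 1 [← hinv γ]
      exact inv_mul_cancel γ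
    exact congrArg (fun δ : Γ => δ.1 z) h1
  have r_other : ∀ v w : V(G), v ≠ w → G.IsLink e v w → r v = p v - (φ.toFun e v w).1 (p w) := by
    intro v w hvw hl
    have h1 : ¬ G.IsLoopAt e v := fun h1 => hvw (Subtype.ext (IsLink.right_unique h1 hl))
    have h3 : ∀ (h : G.Inc e v), h.other = w := fun h => h.isLink_other.right_unique hl
    simp only [r, h1, if_false, dif_pos hl.inc_left, h3]
  by_cases hne : a = b
  · subst hne
    have hzero : ∀ v, v ≠ a → ⟪r v, u v⟫_ℝ = 0 := by
      intro v hv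
      have h1 : ¬ G.Inc e v := fun h1 => hv (by
        rcases h1.eq_or_eq_of_isLink hab with h | h <;> exact Subtype.ext h)
      have h2 : ¬ G.IsLoopAt e v := fun h2 => h1 h2.inc
      simp [r, h1, h2]
    rw [Fintype.sum_eq_single a hzero] at hr
    have hra : r a = (2 : ℝ) • (p a - (φ.toFun e a a).1 (p a)) := by
      simp only [r, show G.IsLoopAt e a from hab, if_true, hinv]
      module
    rw [hra, inner_smul_left, conj_trivial] at hr
    set γ := φ.toFun e a a
    -- The vector `p a - γ (p a)` is reversed by `γ`, so the bar condition equals the row applied to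
    -- `u`.
    have h1 : ⟪p a - γ.1 (p a), γ.1 (u a)⟫_ℝ = -⟪p a - γ.1 (p a), u a⟫_ℝ := by
      rw [← γ.1.inner_map_map, hinvol, map_sub, hinvol, ← neg_sub, inner_neg_left]
    rw [inner_sub_right, h1]
    linarith
  · have hzero : ∀ v, v ≠ a ∧ v ≠ b → ⟪r v, u v⟫_ℝ = 0 := by
      intro v hv
      have h1 : ¬ G.Inc e v := fun h1 => by
        rcases h1.eq_or_eq_of_isLink hab with h | h
        exacts [hv.1 (Subtype.ext h), hv.2 (Subtype.ext h)]
      have h2 : ¬ G.IsLoopAt e v := fun h2 => h1 h2.inc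
      simp [r, h1, h2]
    rw [Fintype.sum_eq_add a b hne hzero, r_other a b hne hab, r_other b a (Ne.symm hne) hab.symm,
      φ.inv_eq e b a hab.symm fun h => hne (Subtype.ext h).symm, hinv] at hr
    set γ := φ.toFun e a b
    -- Moving `γ` across the inner product turns the block of the row at `b` into the second half of
    -- the bar condition.
    have h1 : ⟪p a - γ.1 (p b), γ.1 (u b)⟫_ℝ = -⟪p b - γ.1 (p a), u b⟫_ℝ := by
      rw [← γ.1.inner_map_map, hinvol, map_sub, hinvol, ← neg_sub, inner_neg_left]
    rw [inner_sub_right, h1]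
    linarith

end Graph

theorem mainTheorem2 {α β : Type*} (G : Graph α β) [Fintype V(G)] [Fintype E(G)]
    (Γ : Subgroup (EuclideanSpace ℝ (Fin 2) ≃ₗᵢ[ℝ] EuclideanSpace ℝ (Fin 2)))
    (hcyc : IsCyclic Γ) (hcard : Nat.card Γ = 2)
    (htight : G.IsTight 2 1) (htriple : ¬ G.HasParallelTriple) :
    ∃ φ : G.GainMap Γ, φ.IsSymmetricallyRigid := by
  obtain ⟨s, hs, huniq⟩ := (Nat.card_eq_two_iff' (1 : Γ)).1 hcard
  have hss : s * s = 1 := by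
    by_contra h
    exact hs (by simpa using huniq _ h)
  have hcases : ∀ γ : Γ, γ = 1 ∨ γ = s := fun γ => or_iff_not_imp_left.2 (huniq γ)
  have hinv : ∀ γ : Γ, γ⁻¹ = γ := fun γ => by
    rcases hcases γ with rfl | rfl
    · exact inv_one
    · exact inv_eq_of_mul_eq_one_left hss
  have hne : ∃ q, s.1 q ≠ q := by
    by_contra! h
    exact hs (Subtype.ext (LinearIsometryEquiv.ext h))
  obtain ⟨M⟩ := SymmetricMotion.nonempty s.1 (fun z => congrArg (fun δ : Γ => δ.1 z) hss) hne
  obtain ⟨g, hg, p, hp⟩ := (htight.toFinMultigraph htriple).exists_isRigid M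
  refine ⟨Graph.gainMapOfBool g hg hs hss, p, fun u hu => ?_⟩
  obtain ⟨c, hc⟩ := hp u fun e _ a b hab => by
    have := hu.inner_eq_zero hinv (Graph.toFinMultigraph_ends_eq_iff.1 hab)
    simpa only [Graph.gainMapOfBool_apply] using this
  obtain ⟨A, hA, hAT⟩ := exists_skew_matrix M.T M.inner_T
  -- The same matrix and vector serve both group elements, since the motion commutes with `s`.
  refine ⟨c • A, c • M.x, by rw [Matrix.transpose_smul, hA, smul_neg], fun ⟨v, γ⟩ => ?_⟩
  have hcv := hc v (Finset.mem_univ _)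
  simp only [coveringMap, hcv, SymmetricMotion.field, map_smul, LinearMap.smul_apply, hAT,
    ← smul_add, map_add]
  congr 1
  rcases hcases γ with rfl | rfl
  · rfl
  · rw [M.T_comm, M.fix_x]
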